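/- Let $\mathcal C$ be a category with finite coproducts and let $\#:\mathcal C\times\mathcal C\to\mathcal C$ be a parametrized monad, i.e. a functor $X\mapsto(-\#X)$ from $\mathcal C$ to the category of monads on $\mathcal C$ and monad morphisms; write $u^X_A:A\to A\#X$ and $m^X_A:(A\#X)\#X\to A\#X$ for the unit and multiplication of the monad $-\#X$. A *complete Elgot $\#$-algebra* is an object $A$ with an algebra $a:A\#A\to A$ for the monad $-\#A$ and an operator $(e:Z\to A\#Z)\mapsto(e^{*}:Z\to A)$ such that (solution) $e^{*}=a\circ(\mathrm{id}\#e^{*})\circ e$ for all $e:Z\to A\#Z$; (functoriality) if $e:Z\to A\#Z$, $f:Y\to A\#Y$, $h:Z\to Y$ and $f\circ h=(\mathrm{id}\#h)\circ e$, then $f^{*}\circ h=e^{*}$; (compositionality) $(f\mathbin{\blacksquare}g)^{*}\circ\mathrm{inr}=((f^{*}\#\mathrm{id})\circ g)^{*}$ for all $f:Y\to A\#Y$ and $g:Z\to Y\#Z$, where $$f\mathbin{\blacksquare}g=m^{Y+Z}_A\circ((\mathrm{id}\#\mathrm{inl})\#\mathrm{inr})\circ(f\#\mathrm{id})\circ[u^Z_Y,g]:Y+Z\to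 A\#(Y+Z).$$ A morphism from $(A,a,(-)^{*})$ to $(B,b,(-)^{\circledast})$ is a morphism $h:A\to B$ of $\mathcal C$ such that $((h\#\mathrm{id})\circ e)^{\circledast}=h\circ e^{*}$ for all $e:Z\to A\#Z$. A complete Elgot $\#$-algebra $F$ with a morphism $\eta:X\to F$ is *free on $X$* if for every complete Elgot $\#$-algebra $B$ and every $g:X\to B$ in $\mathcal C$ there is exactly one morphism $h:F\to B$ of complete Elgot $\#$-algebras with $h\circ\eta=g$. **Theorem.** Let $X$ be an object of $\mathcal C$. (i) Let $\mathrm{out}:N\to X\#N$ be a final $(X\#-)$-coalgebra. Then $$N\#N\xrightarrow{\ \mathrm{out}\#\mathrm{id}\ }(X\#N)\#N\xrightarrow{\ m^{N}_X\ }X\#N\xrightarrow{\ \mathrm{out}^{-1}\ }N\qquad\text{and}\qquad X\xrightarrow{\ u^N_X\ }X\#N\xrightarrow{\ \mathrm{out}^{-1}\ }N$$ are the algebra structure and the universal morphism of a free complete Elgot $\#$-algebra on $X$. Its iteration operator sends $e:Z\to N\#Z$ to $(\mathrm{coit}\,c)\circ\mathrm{inr}:Z\to N$, where $c=\mathrm{out}\mathbin{\blacksquare}e:N+Z\to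 X\#(N+Z)$, that is, $c=m^{N+Z}_X\circ((\mathrm{id}\#\mathrm{inl})\#\mathrm{inr})\circ(\mathrm{out}\#\mathrm{id})\circ[u^Z_N,e]$, and $\mathrm{coit}\,c:N+Z\to N$ is the unique coalgebra morphism from $(N+Z,c)$ to $(N,\mathrm{out})$. (ii) Conversely, if a complete Elgot $\#$-algebra with carrier $FX$ and algebra structure $\varphi_X:FX\#FX\to FX$ is free on $X$ with universal morphism $\eta_X:X\to FX$, then $$X\#FX\xrightarrow{\ \eta_X\#\mathrm{id}\ }FX\#FX\xrightarrow{\ \varphi_X\ }FX$$ is an isomorphism, and its inverse is the structure of a final $(X\#-)$-coalgebra. -/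

import Mathlib

open CategoryTheory CategoryTheory.Limits

universe v u

namespace ParamMonad

variable {C : Type u} [Category.{v} C]

/-- The value `A # X` of a parametrized monad. A parametrized monad over `C` is a functor
`P : C ⥤ Monad C` to the category of monads on `C` and monad morphisms; the monad `(-) # X`
is `P.obj X`. -/
abbrev hash (P : C ⥤ Monad C) (A X : C) : C := (P.obj X).obj A

/-- The action `f # g` of the associated bifunctor on morphisms. -/
def hashMap (P : C ⥤ Monad C) {A B X Y : C} (f : A ⟶ B) (g : X ⟶ Y) :
    hash P A X ⟶ hash P B Y :=
  (P.obj X).map f ≫ (P.map g).app B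

/-- The unit `u` of the monad `(-) # X` at `A`. -/
abbrev unit (P : C ⥤ Monad C) (A X : C) : A ⟶ hash P A X := (P.obj X).η.app A

/-- The multiplication `m` of the monad `(-) # X` at `A`. -/
abbrev mult (P : C ⥤ Monad C) (A X : C) : hash P (hash P A X) X ⟶ hash P A X :=
  (P.obj X).μ.app A

theorem hashMap_id (P : C ⥤ Monad C) (A X : C) :
    hashMap P (𝟙 A) (𝟙 X) = 𝟙 (hash P A X) := by
  simp [hashMap]

theorem hashMap_comp (P : C ⥤ Monad C) {A B D X Y Z : C} (f : A ⟶ B) (f' : B ⟶ D)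
    (g : X ⟶ Y) (g' : Y ⟶ Z) :
    hashMap P (f ≫ f') (g ≫ g') = hashMap P f g ≫ hashMap P f' g' := by
  have h := (P.map g).toNatTrans.naturality f'
  simp only [hashMap, Functor.map_comp, MonadHom.comp_toNatTrans, NatTrans.comp_app,
    Category.assoc]
  rw [reassoc_of% h]

/-- The endofunctor `X # (-)` of `C`. -/
@[simps]
def hashRight (P : C ⥤ Monad C) (X : C) : C ⥤ C where
  obj Y := hash P X Y
  map g := hashMap P (𝟙 X) g
  map_id Y := hashMap_id P X Y
  map_comp g g' := by
    conv_lhs => rw [← Category.comp_id (𝟙 X)]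
    exact hashMap_comp P _ _ g g'

section Iteration

variable [HasFiniteCoproducts C]

/-- The morphism `f ■ g : Y + X ⟶ A # (Y + X)` for `f : Y ⟶ A # Y` and `g : X ⟶ Y # X`. -/
noncomputable def square (P : C ⥤ Monad C) {A X Y : C} (f : Y ⟶ hash P A Y)
    (g : X ⟶ hash P Y X) : (Y ⨿ X) ⟶ hash P A (Y ⨿ X) :=
  coprod.desc (unit P Y X) g ≫ hashMap P f (𝟙 X) ≫
    hashMap P (hashMap P (𝟙 A) (coprod.inl : Y ⟶ Y ⨿ X)) (coprod.inr : X ⟶ Y ⨿ X) ≫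
      mult P A (Y ⨿ X)

/-- The structure of a complete Elgot `#`-algebra on the object `A`: a `#`-algebra structure
`a : A # A ⟶ A`, i.e. an algebra for the monad `(-) # A`, and an iteration operator satisfying
the solution, functoriality and compositionality axioms. -/
structure ElgotStructure (P : C ⥤ Monad C) (A : C) where
  /-- the `#`-algebra structure -/
  a : hash P A A ⟶ A
  unit_a : unit P A A ≫ a = 𝟙 A
  mult_a : mult P A A ≫ a = hashMap P a (𝟙 A) ≫ a
  /-- the iteration operator -/
  iter : ∀ {X : C}, (X ⟶ hash P A X) → (X ⟶ A)
  solution : ∀ {X : C} (e : X ⟶ hash P A X), iter e = e ≫ hashMap P (𝟙 A) (iter e) ≫ a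
  functoriality : ∀ {X Y : C} (e : X ⟶ hash P A X) (f : Y ⟶ hash P A Y) (h : X ⟶ Y),
    h ≫ f = e ≫ hashMap P (𝟙 A) h → h ≫ iter f = iter e
  compositionality : ∀ {X Y : C} (f : Y ⟶ hash P A Y) (g : X ⟶ hash P Y X),
    (coprod.inr : X ⟶ Y ⨿ X) ≫ iter (square P f g) = iter (g ≫ hashMap P (iter f) (𝟙 X))

/-- A complete Elgot `#`-algebra. -/
structure ElgotAlgebra (P : C ⥤ Monad C) where
  /-- the carrier -/
  carrier : C
  /-- the `#`-algebra structure and the iteration operator -/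
  str : ElgotStructure P carrier

namespace ElgotAlgebra

variable {P : C ⥤ Monad C}

/-- A morphism of complete Elgot `#`-algebras is a morphism of the carriers that preserves
iteration. -/
@[ext]
structure Hom (A B : ElgotAlgebra P) where
  /-- the underlying morphism -/
  f : A.carrier ⟶ B.carrier
  map_iter : ∀ {X : C} (e : X ⟶ hash P A.carrier X),
    B.str.iter (e ≫ hashMap P f (𝟙 X)) = A.str.iter e ≫ f

/-- The category of complete Elgot `#`-algebras. -/
instance : Category (ElgotAlgebra P) where
  Hom := Hom
  id A := ⟨𝟙 _, fun e => by simp [hashMap_id]⟩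
  comp {A B D} g h := ⟨g.f ≫ h.f, fun {X} e => by
    have h1 : hashMap P (g.f ≫ h.f) (𝟙 X) = hashMap P g.f (𝟙 X) ≫ hashMap P h.f (𝟙 X) := by
      rw [← hashMap_comp, Category.comp_id]
    rw [h1, ← Category.assoc, h.map_iter, g.map_iter, Category.assoc]⟩
  id_comp g := Hom.ext (Category.id_comp g.f)
  comp_id g := Hom.ext (Category.comp_id g.f)
  assoc g h k := Hom.ext (Category.assoc g.f h.f k.f)

/-- The complete Elgot `#`-algebra `F` is free on `X` with universal morphism `η`. -/
def IsFree (F : ElgotAlgebra P) {X : C} (η : X ⟶ F.carrier) : Prop :=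
  ∀ (B : ElgotAlgebra P) (g : X ⟶ B.carrier), ∃! h : F ⟶ B, η ≫ h.f = g

end ElgotAlgebra

end Iteration

end ParamMonad

/-! For (i), `s` solves `e` in `N` exactly when `[id, s]` is a coalgebra morphism from `out ■ e` to
`out` (`comp_eq_square_hashMap`). Finality thus makes solutions unique, and uniqueness yields
functoriality and compositionality (`ofUniqueSolutions`). The extension of `g : X ⟶ B` is the
iterate in `B` of `out` relabelled along `g`; it preserves iteration by compositionality and
functoriality in `B` (`iter_hashMap_iter`). It is the only extension because relabelling `out` along
the universal morphism has iterate `id`.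

For (ii), a Lambek-style argument: `X # F` is itself an Elgot algebra (`hashLeft`) with a morphism
to `F`, which freeness inverts (`IsFree.exists_iso`). Coalgebra morphisms into `F` are then exactly
iterates (`IsFree.comp_eq_iff`). -/

namespace ParamMonad

/-! ### Laws of `#` and of `■` -/

section Laws

variable {C : Type u} [Category.{v} C] (P : C ⥤ Monad C)

theorem hashMap_hashMap {A B D X Y Z : C} (f : A ⟶ B) (f' : B ⟶ D) (g : X ⟶ Y) (g' : Y ⟶ Z) :
    hashMap P f g ≫ hashMap P f' g' = hashMap P (f ≫ f') (g ≫ g') :=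
  (hashMap_comp P f f' g g').symm

theorem hashMap_hashMap_assoc {A B D X Y Z W : C} (f : A ⟶ B) (f' : B ⟶ D) (g : X ⟶ Y)
    (g' : Y ⟶ Z) (h : hash P D Z ⟶ W) :
    hashMap P f g ≫ hashMap P f' g' ≫ h = hashMap P (f ≫ f') (g ≫ g') ≫ h := by
  rw [← Category.assoc, hashMap_hashMap]

theorem unit_hashMap {A B X Y : C} (f : A ⟶ B) (g : X ⟶ Y) :
    unit P A X ≫ hashMap P f g = f ≫ unit P B Y := by
  have h1 := (P.obj X).η.naturality f
  have h2 := (P.map g).app_η B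
  simp only [Functor.id_map] at h1
  simp only [hashMap, unit]
  rw [← reassoc_of% h1, h2]

theorem unit_hashMap_assoc {A B X Y W : C} (f : A ⟶ B) (g : X ⟶ Y) (h : hash P B Y ⟶ W) :
    unit P A X ≫ hashMap P f g ≫ h = f ≫ unit P B Y ≫ h := by
  rw [← Category.assoc, unit_hashMap, Category.assoc]

theorem mult_hashMap {A B X Y : C} (f : A ⟶ B) (g : X ⟶ Y) :
    mult P A X ≫ hashMap P f g = hashMap P (hashMap P f g) g ≫ mult P B Y := by
  have h1 := (P.obj X).μ.naturality f
  have h2 := (P.map g).app_μ B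
  simp only [Functor.comp_map] at h1
  simp only [hashMap, mult, Functor.map_comp, Category.assoc] at h2 ⊢
  rw [← reassoc_of% h1, h2]

theorem mult_hashMap_assoc {A B X Y W : C} (f : A ⟶ B) (g : X ⟶ Y) (h : hash P B Y ⟶ W) :
    mult P A X ≫ hashMap P f g ≫ h = hashMap P (hashMap P f g) g ≫ mult P B Y ≫ h := by
  rw [← Category.assoc, mult_hashMap, Category.assoc]

theorem unit_mult (A X : C) : unit P (hash P A X) X ≫ mult P A X = 𝟙 (hash P A X) :=
  (P.obj X).left_unit A

theorem hashMap_unit_mult (A X : C) :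
    hashMap P (unit P A X) (𝟙 X) ≫ mult P A X = 𝟙 (hash P A X) := by
  simp [hashMap]

theorem hashMap_mult_mult (A X : C) :
    hashMap P (mult P A X) (𝟙 X) ≫ mult P A X = mult P (hash P A X) X ≫ mult P A X := by
  simpa [hashMap] using (P.obj X).assoc A

theorem hashMap_mult_mult_assoc {A X W : C} (h : hash P A X ⟶ W) :
    hashMap P (mult P A X) (𝟙 X) ≫ mult P A X ≫ h = mult P (hash P A X) X ≫ mult P A X ≫ h := by
  rw [← Category.assoc, hashMap_mult_mult, Category.assoc]

variable [HasFiniteCoproducts C]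

theorem inl_square {A X Y : C} (f : Y ⟶ hash P A Y) (g : X ⟶ hash P Y X) :
    (coprod.inl : Y ⟶ Y ⨿ X) ≫ square P f g = f ≫ hashMap P (𝟙 A) coprod.inl := by
  rw [square, coprod.inl_desc_assoc, unit_hashMap_assoc, unit_hashMap_assoc, unit_mult,
    Category.comp_id]

theorem inl_square_assoc {A X Y W : C} (f : Y ⟶ hash P A Y) (g : X ⟶ hash P Y X)
    (h : hash P A (Y ⨿ X) ⟶ W) :
    (coprod.inl : Y ⟶ Y ⨿ X) ≫ square P f g ≫ h = f ≫ hashMap P (𝟙 A) coprod.inl ≫ h := by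
  rw [← Category.assoc, inl_square, Category.assoc]

theorem inr_square_hashMap {A B X Y W : C} (f : Y ⟶ hash P A Y) (g : X ⟶ hash P Y X)
    (p : A ⟶ B) (k : Y ⨿ X ⟶ W) :
    (coprod.inr : X ⟶ Y ⨿ X) ≫ square P f g ≫ hashMap P p k =
      g ≫ hashMap P (f ≫ hashMap P p (coprod.inl ≫ k)) (coprod.inr ≫ k) ≫ mult P B W := by
  simp only [square, coprod.inr_desc_assoc, Category.assoc, mult_hashMap,
    hashMap_hashMap_assoc, Category.id_comp, hashMap_hashMap]

theorem square_hashMap {A B X Y : C} (f : Y ⟶ hash P A Y) (g : X ⟶ hash P Y X) (p : A ⟶ B) :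
    square P f g ≫ hashMap P p (𝟙 (Y ⨿ X)) = square P (f ≫ hashMap P p (𝟙 Y)) g := by
  simp only [square, Category.assoc, mult_hashMap, hashMap_hashMap_assoc, Category.id_comp,
    Category.comp_id, hashMap_hashMap]

/-- `k` is a coalgebra morphism from `f ■ e` to `f` as soon as it restricts to the identity on the
left and to a solution on the right. -/
theorem comp_eq_square_hashMap {X N Z : C} (f : N ⟶ hash P X N) (e : Z ⟶ hash P N Z)
    (s : Z ⟶ N) (hs : s ≫ f = e ≫ hashMap P f s ≫ mult P X N) :
    coprod.desc (𝟙 N) s ≫ f = square P f e ≫ hashMap P (𝟙 X) (coprod.desc (𝟙 N) s) := by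
  apply coprod.hom_ext
  · rw [coprod.inl_desc_assoc, inl_square_assoc, hashMap_hashMap, coprod.inl_desc,
      Category.id_comp, Category.id_comp, hashMap_id, Category.comp_id]
  · rw [coprod.inr_desc_assoc, inr_square_hashMap, coprod.inl_desc, coprod.inr_desc, hashMap_id,
      Category.comp_id, hs]

end Laws

section Elgot

variable {C : Type u} [Category.{v} C] [HasFiniteCoproducts C] {P : C ⥤ Monad C}

/-! ### Constructions on Elgot structures -/

namespace ElgotStructure

/-- A `#`-algebra with unique solutions is a complete Elgot `#`-algebra. -/
def ofUniqueSolutions {A : C} (a : hash P A A ⟶ A) (unit_a : unit P A A ≫ a = 𝟙 A)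
    (mult_a : mult P A A ≫ a = hashMap P a (𝟙 A) ≫ a)
    (iter : ∀ {Z : C}, (Z ⟶ hash P A Z) → (Z ⟶ A))
    (iter_iff : ∀ {Z : C} (e : Z ⟶ hash P A Z) (s : Z ⟶ A),
      s = e ≫ hashMap P (𝟙 A) s ≫ a ↔ s = iter e) : ElgotStructure P A where
  a := a
  unit_a := unit_a
  mult_a := mult_a
  iter := iter
  solution e := (iter_iff e _).2 rfl
  functoriality e f h hf := by
    rw [← iter_iff]
    conv_lhs => rw [(iter_iff f _).2 rfl]
    rw [reassoc_of% hf, hashMap_hashMap_assoc, Category.comp_id]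
  compositionality {X Y} f g := by
    have hs := (iter_iff (square P f g) _).2 rfl
    set s := iter (square P f g)
    have hl : (coprod.inl : Y ⟶ Y ⨿ X) ≫ s = iter f := by
      rw [← iter_iff]
      conv_lhs => rw [hs]
      rw [inl_square_assoc, hashMap_hashMap_assoc, Category.comp_id]
    rw [← iter_iff]
    conv_lhs => rw [hs, ← Category.assoc (square P f g), ← Category.assoc, inr_square_hashMap, hl]
    have hf : f ≫ hashMap P (𝟙 A) (iter f) ≫ a = iter f := ((iter_iff f _).2 rfl).symm
    simp only [Category.assoc, mult_a, hashMap_hashMap_assoc, hf, Category.comp_id,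
      Category.id_comp]

variable {A : C} (S : ElgotStructure P A)

theorem inl_iter_square {X Y : C} (f : Y ⟶ hash P A Y) (g : X ⟶ hash P Y X) :
    (coprod.inl : Y ⟶ Y ⨿ X) ≫ S.iter (square P f g) = S.iter f :=
  S.functoriality _ _ _ (inl_square P f g)

/-- Iterating the coalgebra `f` along `g : X ⟶ A` carries a solution `s` of `e` to the iterate
of `e`. -/
theorem iter_hashMap_iter {X N Z : C} (f : N ⟶ hash P X N) (g : X ⟶ A) (e : Z ⟶ hash P N Z)
    (s : Z ⟶ N) (hs : s ≫ f = e ≫ hashMap P f s ≫ mult P X N) :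
    S.iter (e ≫ hashMap P (S.iter (f ≫ hashMap P g (𝟙 N))) (𝟙 Z)) =
      s ≫ S.iter (f ≫ hashMap P g (𝟙 N)) := by
  -- Compositionality exposes the iterate of the relabelled `f ■ e`; functoriality along `[id, s]`
  -- reduces it to that of the relabelled `f`.
  rw [← S.compositionality, ← square_hashMap,
    ← S.functoriality _ (f ≫ hashMap P g (𝟙 N)) (coprod.desc (𝟙 N) s), coprod.inr_desc_assoc]
  rw [reassoc_of% comp_eq_square_hashMap P f e s hs]
  simp only [Category.assoc, hashMap_hashMap, Category.id_comp, Category.comp_id]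

/-- The value of `iter (f ≫ hashMap P g (𝟙 N))` at points where `f` is the unit. -/
theorem comp_iter_of_comp_eq_unit {X N : C} (f : N ⟶ hash P X N) (g : X ⟶ A) (η : X ⟶ N)
    (h : η ≫ f = unit P X N) : η ≫ S.iter (f ≫ hashMap P g (𝟙 N)) = g := by
  rw [S.solution]
  simp only [Category.assoc]
  rw [reassoc_of% h, hashMap_hashMap_assoc, unit_hashMap_assoc, Category.comp_id, S.unit_a,
    Category.comp_id]

/-- The morphism `X # A ⟶ A` induced by `X ⟶ A`. -/
def ext {X : C} (η : X ⟶ A) : hash P X A ⟶ A := hashMap P η (𝟙 A) ≫ S.a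

theorem mult_ext {X : C} (η : X ⟶ A) :
    mult P X A ≫ S.ext η = hashMap P (S.ext η) (𝟙 A) ≫ S.a := by
  rw [ext, mult_hashMap_assoc, S.mult_a, hashMap_hashMap_assoc, Category.comp_id]

theorem unit_ext {X : C} (η : X ⟶ A) : unit P X A ≫ S.ext η = η := by
  rw [ext, unit_hashMap_assoc, S.unit_a, Category.comp_id]

/-- By `mult_ext` this is the solution axiom of `A`. It makes `S.ext η` preserve the iteration of
`hashLeft`. -/
theorem hashMap_iter_ext {X Z : C} (η : X ⟶ A) (e : Z ⟶ hash P (hash P X A) Z) :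
    e ≫ hashMap P (𝟙 _) (S.iter (e ≫ hashMap P (S.ext η) (𝟙 Z))) ≫ mult P X A ≫ S.ext η =
      S.iter (e ≫ hashMap P (S.ext η) (𝟙 Z)) := by
  conv_rhs => rw [S.solution]
  simp only [Category.assoc, mult_ext, hashMap_hashMap_assoc, Category.id_comp, Category.comp_id]

/-- The complete Elgot `#`-algebra on `X # A` induced by `η : X ⟶ A`. -/
def hashLeft {X : C} (η : X ⟶ A) : ElgotStructure P (hash P X A) where
  a := hashMap P (𝟙 _) (S.ext η) ≫ mult P X A
  unit_a := by rw [unit_hashMap_assoc, unit_mult, Category.id_comp]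
  mult_a := by
    rw [mult_hashMap_assoc, hashMap_hashMap_assoc, Category.id_comp,
      ← hashMap_mult_mult, hashMap_hashMap_assoc, Category.comp_id, Category.comp_id]
  -- Solve in `A` after pushing `e` along `S.ext η`, then unfold `e` once to land in `X # A`.
  iter e := e ≫ hashMap P (𝟙 _) (S.iter (e ≫ hashMap P (S.ext η) (𝟙 _))) ≫ mult P X A
  solution e := by
    rw [hashMap_hashMap_assoc, Category.comp_id]
    simp only [Category.assoc, hashMap_iter_ext]
  functoriality e f h hf := by
    rw [reassoc_of% hf, hashMap_hashMap_assoc, Category.comp_id, S.functoriality]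
    rw [reassoc_of% hf]
    simp only [Category.assoc, hashMap_hashMap, Category.id_comp, Category.comp_id]
  compositionality {Z Y} f g := by
    set fi := f ≫ hashMap P (𝟙 _) (S.iter (f ≫ hashMap P (S.ext η) (𝟙 _))) ≫ mult P X A with hfi
    have h1 : fi ≫ S.ext η = S.iter (f ≫ hashMap P (S.ext η) (𝟙 _)) := by
      simp only [hfi, Category.assoc, hashMap_iter_ext]
    rw [square_hashMap, ← Category.assoc (square P f g), ← Category.assoc, inr_square_hashMap,
      S.inl_iter_square, S.compositionality]
    simp only [Category.assoc, ← hashMap_mult_mult, hashMap_hashMap_assoc, hashMap_hashMap, h1,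
      Category.comp_id, Category.id_comp, ← hfi]

end ElgotStructure

namespace ElgotAlgebra

/-- Morphisms of complete Elgot `#`-algebras are morphisms of `#`-algebras. -/
theorem Hom.map_a {A B : ElgotAlgebra P} (h : A.Hom B) :
    A.str.a ≫ h.f = hashMap P h.f h.f ≫ B.str.a := by
  let Q := hash P A.carrier A.carrier
  -- On the right summand `e` stops at once; on the left it calls only the right summand. Its
  -- iterate on the left is therefore the algebra structure itself.
  let e : Q ⨿ A.carrier ⟶ hash P A.carrier (Q ⨿ A.carrier) :=
    coprod.desc (hashMap P (𝟙 _) coprod.inr) (unit P _ _)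
  have key : ∀ {D : ElgotAlgebra P} (p : A.carrier ⟶ D.carrier),
      coprod.inl ≫ D.str.iter (e ≫ hashMap P p (𝟙 _)) = hashMap P p p ≫ D.str.a := by
    intro D p
    have hr : coprod.inr ≫ D.str.iter (e ≫ hashMap P p (𝟙 _)) = p := by
      rw [D.str.solution]
      simp only [e, Category.assoc, coprod.inr_desc_assoc, hashMap_hashMap_assoc,
        unit_hashMap_assoc, D.str.unit_a, Category.comp_id]
    conv_lhs => rw [D.str.solution]
    simp only [e, Category.assoc, coprod.inl_desc_assoc, hashMap_hashMap_assoc, Category.id_comp,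
      Category.comp_id]
    simp only [e] at hr
    rw [hr]
  have h1 := key (D := A) (𝟙 _)
  rw [hashMap_id, hashMap_id, Category.comp_id, Category.id_comp] at h1
  rw [← h1, Category.assoc, ← h.map_iter, key]

end ElgotAlgebra

/-- A coalgebra `i` for `X # (-)` with unique coalgebra morphisms into it, given by `coit`, yields
a free complete Elgot `#`-algebra. -/
theorem exists_free_of_coit {X N : C} (i : N ≅ hash P X N)
    (coit : ∀ {Z : C}, (Z ⟶ hash P X Z) → (Z ⟶ N))
    (coit_iff : ∀ {Z : C} (c : Z ⟶ hash P X Z) (s : Z ⟶ N),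
      s ≫ i.hom = c ≫ hashMap P (𝟙 X) s ↔ s = coit c) :
    ∃ S : ElgotStructure P N,
      S.a = hashMap P i.hom (𝟙 N) ≫ mult P X N ≫ i.inv ∧
      (∀ {Z : C} (e : Z ⟶ hash P N Z), S.iter e = coprod.inr ≫ coit (square P i.hom e)) ∧
      ElgotAlgebra.IsFree ⟨N, S⟩ (unit P X N ≫ i.inv) := by
  let a : hash P N N ⟶ N := hashMap P i.hom (𝟙 N) ≫ mult P X N ≫ i.inv
  have sol_iff : ∀ {Z : C} (e : Z ⟶ hash P N Z) (s : Z ⟶ N),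
      s = e ≫ hashMap P (𝟙 N) s ≫ a ↔ s ≫ i.hom = e ≫ hashMap P i.hom s ≫ mult P X N := by
    intro Z e s
    rw [← Iso.eq_comp_inv]
    simp only [a, hashMap_hashMap_assoc, Category.id_comp, Category.comp_id, Category.assoc]
  have iter_iff : ∀ {Z : C} (e : Z ⟶ hash P N Z) (s : Z ⟶ N),
      s = e ≫ hashMap P (𝟙 N) s ≫ a ↔ s = coprod.inr ≫ coit (square P i.hom e) := by
    intro Z e s
    rw [sol_iff]
    constructor
    · intro hs
      rw [← (coit_iff _ _).1 (comp_eq_square_hashMap P i.hom e s hs), coprod.inr_desc]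
    · rintro rfl
      have hk := (coit_iff (square P i.hom e) _).2 rfl
      set k := coit (square P i.hom e)
      -- Both sides are coalgebra endomorphisms of `N`.
      have hl : coprod.inl ≫ k = 𝟙 N := by
        rw [(coit_iff i.hom (𝟙 N)).1 (by rw [hashMap_id, Category.comp_id, Category.id_comp]),
          ← coit_iff, Category.assoc, hk, inl_square_assoc, hashMap_hashMap, Category.id_comp]
      rw [Category.assoc, hk, inr_square_hashMap, hl, hashMap_id, Category.comp_id]
  let S : ElgotStructure P N := ElgotStructure.ofUniqueSolutions a
    (by rw [unit_hashMap_assoc, ← Category.assoc (unit P _ _), unit_mult, Category.id_comp,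
      i.hom_inv_id])
    (by
      simp only [a, mult_hashMap_assoc, ← hashMap_mult_mult_assoc, hashMap_hashMap_assoc,
        Category.assoc, i.inv_hom_id, Category.comp_id])
    (fun {Z} e => coprod.inr ≫ coit (square P i.hom e)) iter_iff
  have hsol : ∀ {Z : C} (e : Z ⟶ hash P N Z),
      S.iter e ≫ i.hom = e ≫ hashMap P i.hom (S.iter e) ≫ mult P X N :=
    fun e => (sol_iff e _).1 (S.solution e)
  refine ⟨S, rfl, fun e => rfl, fun B g => ?_⟩
  refine ⟨⟨B.str.iter (i.hom ≫ hashMap P g (𝟙 N)), fun e =>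
    B.str.iter_hashMap_iter i.hom g e _ (hsol e)⟩,
    B.str.comp_iter_of_comp_eq_unit _ _ _ (by simp), ?_⟩
  intro h hh
  apply ElgotAlgebra.Hom.ext
  have hid : S.iter (i.hom ≫ hashMap P (unit P X N ≫ i.inv) (𝟙 N)) = 𝟙 N := by
    refine ((iter_iff _ _).1 ((sol_iff _ _).2 ?_)).symm
    rw [Category.assoc, hashMap_hashMap_assoc, Category.assoc, i.inv_hom_id, Category.comp_id,
      Category.comp_id, hashMap_unit_mult, Category.comp_id, Category.id_comp]
  have h2 := h.map_iter (i.hom ≫ hashMap P (unit P X N ≫ i.inv) (𝟙 N))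
  change _ = S.iter _ ≫ _ at h2
  rw [hid, Category.id_comp, Category.assoc, hashMap_hashMap, Category.comp_id] at h2
  rw [← h2]
  exact congrArg (fun q => B.str.iter (i.hom ≫ hashMap P q (𝟙 N))) hh

namespace ElgotAlgebra

variable {F : ElgotAlgebra P} {X : C} {η : X ⟶ F.carrier}

/-- An endomorphism of a free complete Elgot `#`-algebra that fixes `η` is the identity. -/
theorem IsFree.hom_f_eq_id (hF : F.IsFree η) (h : F ⟶ F) (hh : η ≫ h.f = η) :
    h.f = 𝟙 F.carrier :=
  congrArg Hom.f ((ExistsUnique.unique (y₂ := 𝟙 F) (hF F η) hh (Category.comp_id η)))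

/-- The induced morphism `X # F ⟶ F` is an isomorphism if `F` is free on `X`. -/
theorem IsFree.exists_iso (hF : F.IsFree η) :
    ∃ i : F.carrier ≅ hash P X F.carrier, i.inv = F.str.ext η := by
  let G : ElgotAlgebra P := ⟨hash P X F.carrier, F.str.hashLeft η⟩
  let t : G ⟶ F := ⟨F.str.ext η, fun {Z} e => by
    have h := F.str.hashMap_iter_ext η e
    simp only [G, ElgotStructure.hashLeft, Category.assoc]
    exact h.symm⟩
  obtain ⟨j, hj, -⟩ := hF G (unit P X F.carrier)
  have hjt : j.f ≫ F.str.ext η = 𝟙 _ := hF.hom_f_eq_id (j ≫ t) (by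
    change η ≫ j.f ≫ F.str.ext η = η
    rw [reassoc_of% hj, F.str.unit_ext])
  refine ⟨⟨j.f, F.str.ext η, hjt, ?_⟩, rfl⟩
  -- Preservation of the algebra structure turns `ext` followed by `j` into `(η ≫ j) # (j ≫ ext)`
  -- followed by `mult`, which is a unit law.
  have hja : F.str.a ≫ j.f =
      hashMap P j.f j.f ≫ hashMap P (𝟙 _) (F.str.ext η) ≫ mult P X F.carrier := j.map_a
  conv_lhs => rw [ElgotStructure.ext, Category.assoc, hja]
  rw [hashMap_hashMap_assoc, hashMap_hashMap_assoc, Category.id_comp, hjt, hj, Category.comp_id,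
    hashMap_unit_mult]

/-- Existence is the solution axiom. For uniqueness, functoriality along `s` reduces to `hw`: the
iterate of the relabelled `i.hom` is an endomorphism fixing `η`, hence the identity. -/
theorem IsFree.comp_eq_iff (hF : F.IsFree η) (i : F.carrier ≅ hash P X F.carrier)
    (hi : i.inv = F.str.ext η) {Z : C} (c : Z ⟶ hash P X Z) (s : Z ⟶ F.carrier) :
    s ≫ i.hom = c ≫ hashMap P (𝟙 X) s ↔ s = F.str.iter (c ≫ hashMap P η (𝟙 Z)) := by
  have hη : η ≫ i.hom = unit P X F.carrier := by
    rw [← Iso.eq_comp_inv, hi, F.str.unit_ext]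
  have hw : F.str.iter (i.hom ≫ hashMap P η (𝟙 _)) = 𝟙 _ := by
    refine hF.hom_f_eq_id ⟨_, fun e => F.str.iter_hashMap_iter i.hom η e _ ?_⟩
      (F.str.comp_iter_of_comp_eq_unit i.hom η η hη)
    rw [← Iso.eq_comp_inv, Category.assoc, Category.assoc, hi, F.str.mult_ext, ← hi,
      hashMap_hashMap_assoc, i.hom_inv_id, Category.comp_id]
    exact F.str.solution e
  constructor
  · intro hs
    rw [← F.str.functoriality _ (i.hom ≫ hashMap P η (𝟙 _)) s, hw, Category.comp_id]
    rw [reassoc_of% hs]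
    simp only [Category.assoc, hashMap_hashMap, Category.id_comp, Category.comp_id]
  · rintro rfl
    rw [← Iso.eq_comp_inv, hi, ElgotStructure.ext]
    conv_lhs => rw [F.str.solution]
    simp only [Category.assoc, hashMap_hashMap_assoc, Category.id_comp, Category.comp_id]

end ElgotAlgebra

end Elgot

end ParamMonad

open ParamMonad in
theorem mainTheorem2 {C : Type u} [Category.{v} C] [HasFiniteCoproducts C]
    (P : C ⥤ Monad C) (X : C) :
    (∀ (T : Endofunctor.Coalgebra (hashRight P X)) (hT : IsTerminal T),
      ∃ S : ElgotStructure P T.V,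
        S.a = hashMap P (T.str : T.V ⟶ hash P X T.V) (𝟙 T.V) ≫ mult P X T.V ≫
          Endofunctor.Coalgebra.Terminal.strInv hT ∧
        (∀ {Z : C} (e : Z ⟶ hash P T.V Z),
          S.iter e = (coprod.inr : Z ⟶ T.V ⨿ Z) ≫
            (hT.from ⟨T.V ⨿ Z, square P (T.str : T.V ⟶ hash P X T.V) e⟩).f) ∧
        ElgotAlgebra.IsFree ⟨T.V, S⟩
          (unit P X T.V ≫ Endofunctor.Coalgebra.Terminal.strInv hT)) ∧
    (∀ (F : ElgotAlgebra P) (η : X ⟶ F.carrier), F.IsFree η →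
      ∃ i : F.carrier ≅ hash P X F.carrier,
        i.inv = hashMap P η (𝟙 F.carrier) ≫ F.str.a ∧
        Nonempty (IsTerminal (⟨F.carrier, i.hom⟩ : Endofunctor.Coalgebra (hashRight P X)))) := by
  refine ⟨fun T hT => ?_, fun F η hF => ?_⟩
  · refine exists_free_of_coit
      (⟨T.str, Endofunctor.Coalgebra.Terminal.strInv hT,
        Endofunctor.Coalgebra.Terminal.right_inv hT,
        Endofunctor.Coalgebra.Terminal.left_inv hT⟩ : T.V ≅ hash P X T.V)
      (fun {Z} c => (hT.from ⟨Z, c⟩).f) (fun {Z} c s => ⟨fun hs => ?_, ?_⟩)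
    · exact congrArg Endofunctor.Coalgebra.Hom.f (hT.hom_ext
        (⟨s, hs.symm⟩ : (⟨Z, c⟩ : Endofunctor.Coalgebra (hashRight P X)) ⟶ T) (hT.from ⟨Z, c⟩))
    · rintro rfl
      exact (hT.from ⟨Z, c⟩).h.symm
  · obtain ⟨i, hi⟩ := hF.exists_iso
    refine ⟨i, hi, ⟨IsTerminal.ofUniqueHom (fun c =>
      ⟨F.str.iter (c.str ≫ hashMap P η (𝟙 c.V)), ((hF.comp_eq_iff i hi c.str _).2 rfl).symm⟩)
      fun c m => ?_⟩⟩
    exact Endofunctor.Coalgebra.Hom.ext ((hF.comp_eq_iff i hi c.str m.f).1 m.h.symm)
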